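/- Let $\nu$ be a Lévy measure on $\mathbb{R}$ (that is, $\nu(\{0\})=0$ and $\int (x^2\wedge 1)\,\nu(dx)<\infty$), and let $X$ be a Lévy process with generating triplet $(0,0,\nu)$, where the generating triplet $(c,\sigma^2,\nu)$ is understood with the truncation function $\mathbf 1_{\{|x|\le 1\}}$, i.e. $$\mathbb{E}\,e^{iuX(t)}=\exp\Big(t\Big(icu-\tfrac{\sigma^2u^2}{2}+\int\big(e^{iux}-1-iux\mathbf 1_{\{|x|\le1\}}\big)\,\nu(dx)\Big)\Big).$$ Let $\gamma_0>0$, $\alpha\in(0,2)$, $\epsilon\in(0,2-\alpha)$, and suppose that there is a Borel measure $\mu$ on $\mathbb{R}$ such that - $\mu(B)\le\nu(B)$ for every Borel set $B\subseteq(-\gamma_0,\gamma_0)$; - the function $f(x)=\mu\big((-\infty,-x]\cup[x,\infty)\big)$ takes values in $(0,\infty)$ for $x\in(0,\infty)$ and is regularly varying at $0$ with index $-(\alpha+\epsilon)$, i.e. $\lim_{x\to\infty} f(1/(sx))/f(1/x)=s^{\alpha+\epsilon}$ for every $s>0$. Then: 1. There is a constant $C<\infty$ such that for every $\gamma\ge\gamma_0$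 and every $t>0$, if $X^{<\gamma}$ denotes the Lévy process with generating triplet $(0,0,\nu|_{(-\gamma,\gamma)})$, the law of $X^{<\gamma}(t)$ has a density $f_{X^{<\gamma}(t)}$ with respect to Lebesgue measure, and $$\|f_{X^{<\gamma}(t)}\|_\infty\le\frac{C}{t^{1/\alpha}\wedge 1}.$$ 2. For every $z_0>0$ there exist $C>0$ and $a>0$ such that for all $z\ge z_0$, $t>0$, $x\in\mathbb{R}$ and $\delta\in[0,1]$, $$\mathbb{P}\big(Y^{<z}(t)\in[x,x+\delta]\big)\le\frac{C}{t^{a}\wedge1}\,\delta,$$ where $Y^{<z}$ is the Lévy process with generating triplet $(0,0,\nu|_{(-\infty,z)})$. -/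

import Mathlib

open MeasureTheory ProbabilityTheory Filter Topology Set
open scoped NNReal ENNReal

universe u

/-- A Lévy measure on `ℝ`: no mass at the origin and `∫ (x² ∧ 1) ν(dx) < ∞`. -/
structure IsLevyMeasure (ν : Measure ℝ) : Prop where
  zero : ν {0} = 0
  lintegral_lt_top : ∫⁻ x, ENNReal.ofReal (min (x ^ 2) 1) ∂ν < ∞

/-- The Lévy–Khintchine exponent of the triplet `(c, σ², ν)`, with the truncation function
`1_{|x| ≤ 1}`; the argument `σsq` is the variance `σ²` of the Brownian part. -/
noncomputable def levyExponent (c : ℝ) (σsq : ℝ≥0) (ν : Measure ℝ) (u : ℝ) : ℂ :=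
  Complex.I * (c : ℂ) * (u : ℂ) - (σsq : ℂ) * (u : ℂ) ^ 2 / 2
    + ∫ x, (Complex.exp (Complex.I * (u : ℂ) * (x : ℂ)) - 1
        - Complex.I * (u : ℂ) * (if |x| ≤ 1 then (x : ℂ) else 0)) ∂ν

/-- A real-valued Lévy process on the probability space `(Ω, P)`: it starts at `0`, has independent
and stationary increments, is continuous in probability, and almost all its paths are
right-continuous with left limits. -/
structure IsLevyProcess {Ω : Type*} [MeasurableSpace Ω] (X : ℝ≥0 → Ω → ℝ) (P : Measure Ω) :
    Prop where
  measurable : ∀ t, Measurable (X t)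
  zero : ∀ᵐ ω ∂P, X 0 ω = 0
  indep : HasIndepIncrements X P
  stationary : ∀ s t, IdentDistrib (fun ω => X (s + t) ω - X s ω) (fun ω => X t ω - X 0 ω) P P
  continuous_in_probability : ∀ t, TendstoInMeasure P X (𝓝 t) (X t)
  cadlag : ∀ᵐ ω ∂P, ∀ t, ContinuousWithinAt (fun s => X s ω) (Ioi t) t ∧
    ∃ l, Tendsto (fun s => X s ω) (𝓝[<] t) (𝓝 l)

/-- `X` is a Lévy process with generating triplet `(c, σ², ν)`. -/
structure IsLevyProcessWithTriplet {Ω : Type*} [MeasurableSpace Ω] (X : ℝ≥0 → Ω → ℝ)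
    (P : Measure Ω) (c : ℝ) (σsq : ℝ≥0) (ν : Measure ℝ) : Prop where
  isLevyProcess : IsLevyProcess X P
  isLevyMeasure : IsLevyMeasure ν
  charFun_eq : ∀ (t : ℝ≥0) (u : ℝ),
    charFun (P.map (X t)) u = Complex.exp ((t : ℂ) * levyExponent c σsq ν u)

/-- `φ : (0,∞) → (0,∞)` is Borel measurable and regularly varying at `+∞` with index `ρ`.
Only the values of `φ` on `(0,∞)` matter. -/
structure RegularlyVaryingAtTop (φ : ℝ → ℝ) (ρ : ℝ) : Prop where
  measurable : Measurable (fun x : Ioi (0 : ℝ) => φ x)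
  pos : ∀ x, 0 < x → 0 < φ x
  tendsto : ∀ t, 0 < t → Tendsto (fun x => φ (t * x) / φ x) atTop (𝓝 (t ^ ρ))

/-- `h : (0,∞) → (0,∞)` is regularly varying at `0` with index `ρ`: the function `x ↦ h (1 / x)`
is regularly varying at `+∞` with index `-ρ`. -/
def RegularlyVaryingAtZero (h : ℝ → ℝ) (ρ : ℝ) : Prop :=
  RegularlyVaryingAtTop (fun x => h (1 / x)) (-ρ)

/-- The distributional assumption with smoothness exponent `θ` on the Lévy processes with triplet
`(c, σ², ν)`: for every `z₀ > 0` there are `C, a > 0` such that for all `z ≥ z₀`, the Lévy process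
`X^{<z}` with triplet `(c, σ², ν|_{(-∞, z)})`, that is, without the jumps of size at least `z`,
satisfies `P(X^{<z}(t) ∈ [x, x + δ]) ≤ C δ^θ / (t^a ∧ 1)` for all `t > 0`, `x ∈ ℝ`,
`δ ∈ [0, 1]`. -/
def SmallJumpAnticoncentration (c : ℝ) (σsq : ℝ≥0) (ν : Measure ℝ) (θ : ℝ) : Prop :=
  ∀ z₀ : ℝ, 0 < z₀ → ∃ C : ℝ, 0 < C ∧ ∃ a : ℝ, 0 < a ∧
    ∀ z : ℝ, z₀ ≤ z →
    ∀ (Ω : Type u) [MeasurableSpace Ω] (P : Measure Ω) [IsProbabilityMeasure P]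
      (Y : ℝ≥0 → Ω → ℝ), IsLevyProcessWithTriplet Y P c σsq (ν.restrict (Iio z)) →
    ∀ t : ℝ≥0, 0 < t → ∀ x δ : ℝ, δ ∈ Icc (0 : ℝ) 1 →
      P.real (Y t ⁻¹' Icc x (x + δ)) ≤ C / min ((t : ℝ) ^ a) 1 * δ ^ θ

/-! The proof is Fourier-analytic. A law whose characteristic function is dominated by an integrable
`G` is at most `(∫ G) • volume` (`le_smul_volume_of_norm_charFun_le`). For the triplet `(0, 0, ν)`
the characteristic function at `u` has modulus `exp (-t ∫ (1 - cos (u x)) dν)`. On the annulus `1 /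
(2|u|) ≤ |x| < 1 / |u|` the integrand is bounded below, and for large `|u|` the annulus lies where
`ν` dominates `μ`. Its `μ`-mass is a difference of tails, at least `c |u| ^ α` because the tail
index exceeds `α` (`exists_mul_rpow_le_measureReal_annulus`). Integrating `exp (-t c |u| ^ α)` for
large `|u|`, and `1` elsewhere, gives order `1 + t ^ (-1 / α)`. The constants depend only on `μ`,
`α`, the tail index and the radius of domination, hence the uniformity over truncations. -/

/-! ### Densities from characteristic functions. -/

/-- A measure on `ℝ` whose mass on every interval `(a, b]` is at most `c (b - a)` is at most
`c` times Lebesgue measure. -/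
theorem le_smul_volume_of_Ioc_le {P : Measure ℝ} {c : ℝ≥0}
    (h : ∀ a b, P (Ioc a b) ≤ ENNReal.ofReal (c * (b - a))) : P ≤ c • volume := by
  have hvol : c • (volume : Measure ℝ) = (c • StieltjesFunction.id).measure := by
    rw [StieltjesFunction.measure_smul, Real.volume_eq_stieltjes_id]
  rw [hvol, ← Measure.toOuterMeasure_le, StieltjesFunction.measure_def]
  change _ ≤ StieltjesFunction.outer _
  rw [StieltjesFunction.outer, OuterMeasure.le_ofFunction]
  intro s
  rw [StieltjesFunction.length_eq]
  refine le_iInf fun a => le_iInf fun b => le_iInf fun hs => ?_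
  -- `ℝ` has no least element, so there is no bottom point to remove.
  have hbot : (botSet : Set ℝ) = ∅ := by
    ext x
    simp [botSet]
  rw [hbot, sdiff_empty] at hs
  refine (measure_mono hs).trans ((h a b).trans (le_of_eq ?_))
  change _ = ENNReal.ofReal ((c : ℝ) * b - (c : ℝ) * a)
  rw [mul_sub]

/-- The Gaussian smoothing of a probability measure at a point is bounded by the integral of any
function that dominates the characteristic function. -/
theorem integral_exp_neg_sq_le_of_norm_charFun_le {P : Measure ℝ} [IsProbabilityMeasure P]
    {G : ℝ → ℝ} (hG : Integrable G) (hP : ∀ u, ‖charFun P u‖ ≤ G u) (x : ℝ) {v : ℝ≥0}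
    (hv : v ≠ 0) :
    ∫ y, Real.exp (-(v * (y - x) ^ 2 / 2)) ∂P ≤ (√(2 * Real.pi * v))⁻¹ * ∫ u, G u := by
  have hG0 : ∀ u, 0 ≤ G u := fun u => (norm_nonneg _).trans (hP u)
  have hint : Integrable (Function.uncurry fun y z : ℝ =>
      Complex.exp (((y - x : ℝ) : ℂ) * z * Complex.I)) (P.prod (gaussianReal 0 v)) := by
    refine Integrable.of_bound (C := 1) ?_ ?_
    · refine Continuous.aestronglyMeasurable ?_
      simp only [Function.uncurry_def]
      fun_prop
    · refine ae_of_all _ fun p => ?_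
      simp only [Function.uncurry_def]
      rw [← Complex.ofReal_mul, Complex.norm_exp_ofReal_mul_I]
  -- Parseval: integrating first over the Gaussian gives the smoothing kernel, first over `P` gives
  -- `charFun P`.
  have hswap := integral_integral_swap hint
  have hleft : ∀ y : ℝ, ∫ z, Complex.exp (((y - x : ℝ) : ℂ) * z * Complex.I) ∂gaussianReal 0 v
      = ((Real.exp (-(v * (y - x) ^ 2 / 2)) : ℝ) : ℂ) := by
    intro y
    rw [← charFun_apply_real, charFun_gaussianReal]
    push_cast
    congr 1
    ring
  have hright : ∀ z : ℝ, ∫ y, Complex.exp (((y - x : ℝ) : ℂ) * z * Complex.I) ∂P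
      = Complex.exp (((-x * z : ℝ) : ℂ) * Complex.I) * charFun P z := by
    intro z
    rw [charFun_apply_real, ← integral_const_mul]
    congr 1 with y
    rw [← Complex.exp_add]
    congr 1
    push_cast
    ring
  simp_rw [hleft, hright] at hswap
  rw [integral_complex_ofReal, integral_gaussianReal_eq_integral_smul hv] at hswap
  have hnonneg : 0 ≤ ∫ y, Real.exp (-(v * (y - x) ^ 2 / 2)) ∂P :=
    integral_nonneg fun y => (Real.exp_pos _).le
  rw [← abs_of_nonneg hnonneg, ← Real.norm_eq_abs, ← Complex.norm_real, hswap,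
    ← integral_const_mul]
  refine norm_integral_le_of_norm_le (hG.const_mul _) (ae_of_all _ fun u => ?_)
  rw [norm_smul, norm_mul, Complex.norm_exp_ofReal_mul_I, one_mul, Real.norm_eq_abs,
    abs_of_nonneg (gaussianPDFReal_nonneg _ _ _)]
  refine mul_le_mul ?_ (hP u) (norm_nonneg _) (by positivity)
  rw [gaussianPDFReal]
  refine mul_le_of_le_one_right (by positivity) (Real.exp_le_one_iff.2 ?_)
  rw [neg_div]
  exact neg_nonpos.2 (by positivity)

/-- A probability measure whose characteristic function is dominated by the integrable function
`G` is at most `∫ G` times Lebesgue measure. -/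
theorem le_smul_volume_of_norm_charFun_le {P : Measure ℝ} [IsProbabilityMeasure P]
    {G : ℝ → ℝ} (hG : Integrable G) (hP : ∀ u, ‖charFun P u‖ ≤ G u) :
    P ≤ (∫ u, G u).toNNReal • volume := by
  have hG0 : 0 ≤ ∫ u, G u := integral_nonneg fun u => (norm_nonneg _).trans (hP u)
  refine le_smul_volume_of_Ioc_le fun a b => ?_
  rw [Real.coe_toNNReal _ hG0]
  rcases le_or_gt b a with hab | hab
  · simp [Ioc_eq_empty_of_le hab]
  refine (measure_mono (Ioc_subset_Icc_self (a := a) (b := b))).trans ?_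
  rw [← ofReal_measureReal]
  refine ENNReal.ofReal_le_ofReal ?_
  set δ : ℝ := (b - a) / 2 with hδ
  set x : ℝ := (a + b) / 2 with hx
  have hδ0 : 0 < δ := by rw [hδ]; linarith
  -- With this variance the kernel has width `δ`: it is at least `1 / 2` on `[a, b]`, and the
  -- prefactor `(2πv)^(-1/2)` is at most `δ`.
  set v : ℝ≥0 := ⟨(δ ^ 2)⁻¹, by positivity⟩ with hvdef
  have hvc : (v : ℝ) = (δ ^ 2)⁻¹ := rfl
  have hv : v ≠ 0 := by
    rw [← NNReal.coe_ne_zero, hvc]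
    positivity
  have hI := integral_exp_neg_sq_le_of_norm_charFun_le hG hP x hv
  have hint : Integrable (fun y : ℝ => Real.exp (-(v * (y - x) ^ 2 / 2))) P := by
    refine Integrable.of_bound (C := 1) (by fun_prop) (ae_of_all _ fun y => ?_)
    rw [Real.norm_eq_abs, Real.abs_exp, Real.exp_le_one_iff]
    exact neg_nonpos.2 (by positivity)
  have hmarkov := mul_meas_ge_le_integral_of_nonneg
    (ae_of_all _ fun y => (Real.exp_pos _).le) hint (1 / 2)
  have hsub : Icc a b ⊆ {y : ℝ | 1 / 2 ≤ Real.exp (-(v * (y - x) ^ 2 / 2))} := by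
    intro y hy
    have h1 : (v : ℝ) * (y - x) ^ 2 ≤ 1 := by
      rw [hvc, inv_mul_le_one₀ (by positivity)]
      refine sq_le_sq' ?_ ?_ <;> rw [hδ, hx] <;> linarith [hy.1, hy.2]
    have h2 := Real.add_one_le_exp (-(v * (y - x) ^ 2 / 2))
    simp only [mem_ofPred_eq]
    linarith
  have hmono := measureReal_mono (μ := P) hsub
  have hsqrt : (√(2 * Real.pi * v))⁻¹ ≤ δ := by
    refine inv_le_of_inv_le₀ hδ0 ?_
    refine Real.le_sqrt_of_sq_le ?_
    rw [hvc, inv_pow]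
    have := Real.pi_gt_three
    exact le_mul_of_one_le_left (by positivity) (by linarith)
  have := mul_le_mul_of_nonneg_right hsqrt hG0
  have h3 : δ * ∫ u, G u = (∫ u, G u) * (b - a) / 2 := by rw [hδ]; ring
  linarith

/-- A random variable whose law is at most `c` times Lebesgue measure has a density that is
essentially bounded by `c`. -/
theorem hasPDF_and_eLpNorm_pdf_le {Ω : Type*} [MeasurableSpace Ω] {P : Measure Ω}
    [IsProbabilityMeasure P] {X : Ω → ℝ} (hX : Measurable X) {c : ℝ≥0}
    (h : P.map X ≤ c • volume) :
    HasPDF X P volume ∧ eLpNorm (pdf X P volume) ∞ volume ≤ c := by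
  have hac : P.map X ≪ volume :=
    (Measure.absolutelyContinuous_of_le h).trans (Measure.smul_absolutelyContinuous)
  refine ⟨Real.hasPDF_iff.2 ⟨hX.aemeasurable, hac⟩, ?_⟩
  rw [eLpNorm_exponent_top]
  refine eLpNormEssSup_le_of_ae_enorm_bound ?_
  have := ae_le_of_forall_setLIntegral_le_of_sigmaFinite (μ := volume)
    (f := pdf X P volume) (g := fun _ => (c : ℝ≥0∞)) (measurable_pdf X P volume)
    fun s hs _ => ?_
  · filter_upwards [this] with x hx
    simpa using hx
  · rw [pdf_def, setLIntegral_const]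
    exact (Measure.setLIntegral_rnDeriv_le s).trans (h s)

/-! ### Regular variation and the mass of annuli. -/

/-- The increments `φ (2 x) - φ x` of a monotone function that is regularly varying at `+∞` with
index `ρ` grow at least as fast as `x ^ α`, for every `α ∈ (0, ρ)`. -/
theorem RegularlyVaryingAtTop.exists_mul_rpow_le_sub {φ : ℝ → ℝ} {ρ α : ℝ}
    (hφ : RegularlyVaryingAtTop φ ρ) (hmono : MonotoneOn φ (Ioi 0)) (hα : 0 < α) (hαρ : α < ρ) :
    ∃ c > 0, ∃ N > 0, ∀ x ≥ N, c * x ^ α ≤ φ (2 * x) - φ x := by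
  have hlt : (2 : ℝ) ^ α < 2 ^ ρ := Real.rpow_lt_rpow_of_exponent_lt one_lt_two hαρ
  obtain ⟨N₀, hN₀⟩ := eventually_atTop.1 ((hφ.tendsto 2 two_pos).eventually_const_lt hlt)
  set N : ℝ := max N₀ 1 with hN
  have hN0 : 0 < N := lt_max_of_lt_right one_pos
  have hdouble : ∀ x ≥ N, 2 ^ α * φ x ≤ φ (2 * x) := fun x hx =>
    ((lt_div_iff₀ (hφ.pos x (hN0.trans_le hx))).1 (hN₀ x ((le_max_left _ _).trans hx))).le
  have hpow : ∀ n : ℕ, (2 ^ α) ^ n * φ N ≤ φ (2 ^ n * N) := by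
    intro n
    induction n with
    | zero => simp
    | succ n ih =>
      have h1 : N ≤ 2 ^ n * N := le_mul_of_one_le_left hN0.le (one_le_pow₀ one_le_two)
      calc (2 ^ α) ^ (n + 1) * φ N = 2 ^ α * ((2 ^ α) ^ n * φ N) := by ring
        _ ≤ 2 ^ α * φ (2 ^ n * N) := by gcongr
        _ ≤ φ (2 * (2 ^ n * N)) := hdouble _ h1
        _ = φ (2 ^ (n + 1) * N) := by ring_nf
  have h2α : (1 : ℝ) < 2 ^ α := Real.one_lt_rpow one_lt_two hα
  have hφN := hφ.pos N hN0
  -- Doubling gains a factor `2 ^ α`, so the increment is at least `(2 ^ α - 1) φ x`; rounding `x`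
  -- down to some `2 ^ n * N` costs at most a factor `2`, whence `2 * N`.
  refine ⟨(2 ^ α - 1) * (φ N / (2 * N) ^ α), mul_pos (by linarith) (by positivity), N, hN0,
    fun x hx => ?_⟩
  have hx0 : 0 < x := hN0.trans_le hx
  obtain ⟨n, hn1, hn2⟩ := exists_nat_pow_near ((one_le_div hN0).2 hx) one_lt_two
  rw [le_div_iff₀ hN0] at hn1
  rw [div_lt_iff₀ hN0] at hn2
  have hgrow : φ N / (2 * N) ^ α * x ^ α ≤ φ x := by
    calc φ N / (2 * N) ^ α * x ^ α ≤ φ N / (2 * N) ^ α * (2 ^ n * (2 * N)) ^ α := by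
          gcongr
          rw [pow_succ, mul_assoc] at hn2
          exact hn2.le
      _ = (2 ^ α) ^ n * φ N := by
          have hcomm : ((2 : ℝ) ^ n) ^ α = (2 ^ α) ^ n := by
            rw [← Real.rpow_natCast, ← Real.rpow_mul zero_le_two, ← Real.rpow_natCast,
              ← Real.rpow_mul zero_le_two, mul_comm]
          rw [Real.mul_rpow (x := 2 ^ n) (by positivity) (by positivity), hcomm]
          field_simp
      _ ≤ φ (2 ^ n * N) := hpow n
      _ ≤ φ x := hmono (mem_Ioi.2 (by positivity)) (mem_Ioi.2 hx0) hn1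
  have := hdouble x hx
  have := mul_le_mul_of_nonneg_left hgrow (by linarith : (0 : ℝ) ≤ 2 ^ α - 1)
  linarith

/-- If the two-sided tail of `μ` is regularly varying at `0` with index `-ρ`, then the mass of the
annulus `1 / (2 u) ≤ |x| < 1 / u` grows at least as fast as `u ^ α`, for every `α ∈ (0, ρ)`. -/
theorem exists_mul_rpow_le_measureReal_annulus {μ : Measure ℝ} {α ρ : ℝ} (hα : 0 < α)
    (hαρ : α < ρ)
    (hμ : RegularlyVaryingAtZero (fun x => μ.real (Iic (-x) ∪ Ici x)) (-ρ)) :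
    ∃ c > 0, ∃ N > 0, ∀ u ≥ N,
      c * u ^ α ≤ μ.real {x | 1 / (2 * u) ≤ |x| ∧ |x| < 1 / u} := by
  have htail : ∀ r : ℝ, Iic (-r) ∪ Ici r = {x | r ≤ |x|} := by
    intro r
    ext x
    simp only [mem_union, mem_Iic, mem_Ici, mem_ofPred_eq, le_abs']
  unfold RegularlyVaryingAtZero at hμ
  simp only [htail, neg_neg] at hμ
  -- `Measure.real` sends infinite mass to `0`, so positivity of the tail forces finiteness.
  have hfin : ∀ u : ℝ, 0 < u → μ {x | 1 / u ≤ |x|} ≠ ∞ := fun u hu htop => by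
    have := hμ.pos u hu
    simp only [Measure.real, htop, ENNReal.toReal_top, lt_irrefl] at this
  have hmono : MonotoneOn (fun u : ℝ => μ.real {x | 1 / u ≤ |x|}) (Ioi 0) := by
    intro a ha b hb hab
    refine measureReal_mono (fun x hx => ?_) (hfin b hb)
    exact (one_div_le_one_div_of_le ha hab).trans hx
  obtain ⟨c, hc, N, hN, h⟩ := hμ.exists_mul_rpow_le_sub hmono hα hαρ
  refine ⟨c, hc, N, hN, fun u hu => (h u hu).trans (le_of_eq ?_)⟩
  have hu0 : 0 < u := hN.trans_le hu
  have hsub : {x : ℝ | 1 / u ≤ |x|} ⊆ {x | 1 / (2 * u) ≤ |x|} := fun x hx =>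
    (one_div_le_one_div_of_le hu0 (by linarith)).trans hx
  rw [← measureReal_sdiff hsub (measurableSet_le measurable_const measurable_norm)
    (hfin (2 * u) (by positivity))]
  congr 1
  ext x
  simp

/-! ### The real part of the Lévy–Khintchine exponent. -/

theorem norm_exp_mul_I_sub_one_sub_le (y : ℝ) :
    ‖Complex.exp (Complex.I * y) - 1 - Complex.I * y‖ ≤ 3 * y ^ 2 := by
  rcases le_or_gt |y| 1 with hy | hy
  · have h := Complex.norm_exp_sub_one_sub_id_le (x := Complex.I * y) (by simpa using hy)
    have h2 : ‖Complex.I * (y : ℂ)‖ ^ 2 = y ^ 2 := by simp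
    nlinarith [sq_nonneg y]
  · have h1 : ‖Complex.exp (Complex.I * y) - 1‖ ≤ |y| :=
      Real.norm_exp_I_mul_ofReal_sub_one_le
    have h2 : ‖Complex.I * (y : ℂ)‖ = |y| := by simp
    have := norm_sub_le (Complex.exp (Complex.I * y) - 1) (Complex.I * y)
    nlinarith [sq_abs y]

/-- The integrand in the Lévy–Khintchine formula is integrable. -/
theorem IsLevyMeasure.integrable_levyExponent {ν : Measure ℝ} (hν : IsLevyMeasure ν) (u : ℝ) :
    Integrable (fun x : ℝ => Complex.exp (Complex.I * (u : ℂ) * (x : ℂ)) - 1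
        - Complex.I * (u : ℂ) * (if |x| ≤ 1 then (x : ℂ) else 0)) ν := by
  have hmin : Integrable (fun x : ℝ => min (x ^ 2) 1) ν := by
    refine ⟨by fun_prop, ?_⟩
    rw [hasFiniteIntegral_iff_ofReal (ae_of_all _ fun x => by positivity)]
    exact hν.lintegral_lt_top
  refine (hmin.const_mul (3 * u ^ 2 + 2)).mono' ?_ (ae_of_all _ fun x => ?_)
  · refine Measurable.aestronglyMeasurable ?_
    refine Measurable.sub (by fun_prop) (measurable_const.mul ?_)
    exact Measurable.ite (measurableSet_le measurable_norm measurable_const)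
      Complex.measurable_ofReal measurable_const
  · have hcast : Complex.I * (u : ℂ) * (x : ℂ) = Complex.I * ((u * x : ℝ) : ℂ) := by
      push_cast
      ring
    by_cases hx : |x| ≤ 1
    · have hx2 : x ^ 2 ≤ 1 := (sq_le_one_iff_abs_le_one x).2 hx
      rw [if_pos hx, min_eq_left hx2, hcast]
      refine (norm_exp_mul_I_sub_one_sub_le (u * x)).trans ?_
      nlinarith [sq_nonneg x]
    · have hx2 : 1 ≤ x ^ 2 := by
        rw [← sq_abs]
        nlinarith
      rw [if_neg hx, min_eq_right hx2, hcast, mul_zero, sub_zero, mul_one]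
      refine (norm_sub_le _ _).trans ?_
      rw [Complex.norm_exp_I_mul_ofReal, norm_one]
      nlinarith [sq_nonneg u]

/-- The compensator is purely imaginary, so the truncation does not affect the modulus of the
characteristic function. -/
theorem re_exp_mul_I_sub_one_sub (u x : ℝ) :
    (Complex.exp (Complex.I * (u : ℂ) * (x : ℂ)) - 1
        - Complex.I * (u : ℂ) * (if |x| ≤ 1 then (x : ℂ) else 0)).re = Real.cos (u * x) - 1 := by
  have hcast : Complex.I * (u : ℂ) * (x : ℂ) = ((u * x : ℝ) : ℂ) * Complex.I := by
    push_cast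
    ring
  rw [hcast, Complex.sub_re, Complex.sub_re, Complex.exp_ofReal_mul_I_re]
  split_ifs <;> simp

theorem IsLevyMeasure.integrable_one_sub_cos {ν : Measure ℝ} (hν : IsLevyMeasure ν) (u : ℝ) :
    Integrable (fun x => 1 - Real.cos (u * x)) ν := by
  refine (hν.integrable_levyExponent u).re.neg.congr (ae_of_all _ fun x => ?_)
  have := re_exp_mul_I_sub_one_sub u x
  simp only [Pi.neg_apply, RCLike.re_to_complex, this]
  ring

/-- The real part of the exponent of a purely discontinuous Lévy process. -/
theorem IsLevyMeasure.re_levyExponent {ν : Measure ℝ} (hν : IsLevyMeasure ν) (u : ℝ) :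
    (levyExponent 0 0 ν u).re = -∫ x, (1 - Real.cos (u * x)) ∂ν := by
  have h := integral_re (hν.integrable_levyExponent u)
  simp only [RCLike.re_to_complex] at h
  rw [levyExponent, Complex.add_re, ← h, ← integral_neg]
  simp only [re_exp_mul_I_sub_one_sub, neg_sub]
  simp

/-- The mass of the annulus `1 / (2 |u|) ≤ |x| < 1 / |u|` bounds the real part of the
Lévy–Khintchine exponent at `u`. -/
theorem IsLevyMeasure.re_levyExponent_le {ν μ : Measure ℝ} (hν : IsLevyMeasure ν) {r : ℝ}
    (hμν : μ.restrict (Ioo (-r) r) ≤ ν) {u : ℝ} (hu0 : u ≠ 0) (hu : 1 / |u| ≤ r) :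
    (levyExponent 0 0 ν u).re
      ≤ -(1 / (2 * Real.pi ^ 2) * μ.real {x | 1 / (2 * |u|) ≤ |x| ∧ |x| < 1 / |u|}) := by
  rw [hν.re_levyExponent, neg_le_neg_iff]
  have hint := hν.integrable_one_sub_cos u
  have hpi := Real.pi_pos
  have hmarkov := mul_meas_ge_le_integral_of_nonneg
    (ae_of_all _ fun x => sub_nonneg.2 (Real.cos_le_one (u * x))) hint (1 / (2 * Real.pi ^ 2))
  refine le_trans (mul_le_mul_of_nonneg_left ?_ (by positivity)) hmarkov
  have habs : 0 < |u| := abs_pos.2 hu0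
  set A : Set ℝ := {x | 1 / (2 * |u|) ≤ |x| ∧ |x| < 1 / |u|} with hA
  have hAr : A ⊆ Ioo (-r) r := fun x hx => abs_lt.1 (hx.2.trans_le hu)
  have hAcos : A ⊆ {x | 1 / (2 * Real.pi ^ 2) ≤ 1 - Real.cos (u * x)} := by
    intro x hx
    have h1 : |u * x| < 1 := by
      rw [abs_mul, mul_comm]
      exact (lt_div_iff₀ habs).1 hx.2
    have h2 : 1 / 2 ≤ |u * x| := by
      have := (div_le_iff₀ (by positivity)).1 hx.1
      rw [abs_mul]
      linarith
    have h3 : 1 / 4 ≤ (u * x) ^ 2 := by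
      rw [← sq_abs]
      nlinarith
    -- The quadratic bound `cos y ≤ 1 - 2 y² / π²`, combined with `|u x| ≥ 1 / 2`, produces the
    -- constant `1 / (2π²)`.
    have h4 := Real.cos_le_one_sub_mul_cos_sq (x := u * x) (by linarith [Real.pi_gt_three])
    have h5 : 1 / (2 * Real.pi ^ 2) = 2 / Real.pi ^ 2 * (1 / 4) := by
      field_simp
      norm_num
    have h6 : 2 / Real.pi ^ 2 * (1 / 4) ≤ 2 / Real.pi ^ 2 * (u * x) ^ 2 := by gcongr
    simp only [mem_ofPred_eq]
    linarith
  refine ENNReal.toReal_mono (hint.measure_ge_lt_top (by positivity)).ne ?_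
  calc μ A = μ.restrict (Ioo (-r) r) A := (Measure.restrict_eq_self μ hAr).symm
    _ ≤ ν A := hμν A
    _ ≤ _ := measure_mono hAcos

/-! ### Integration of the bound and conclusion. -/

theorem integrable_exp_neg_mul_abs_rpow {b α : ℝ} (hα : 0 < α) (hb : 0 < b) :
    Integrable (fun u : ℝ => Real.exp (-b * |u| ^ α)) := by
  have h := integrableOn_rpow_mul_exp_neg_mul_rpow (s := 0) (by norm_num) hα hb
  simp only [Real.rpow_zero, one_mul] at h
  have hpos : IntegrableOn (fun u : ℝ => Real.exp (-b * |u| ^ α)) (Ioi 0) :=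
    h.congr_fun (fun u hu => by simp only [abs_of_pos (mem_Ioi.1 hu)]) measurableSet_Ioi
  have hneg : IntegrableOn (fun u : ℝ => Real.exp (-b * |u| ^ α)) (Iic 0) := by
    rw [integrableOn_Iic_iff_integrableOn_Iio]
    have h0 : IntegrableOn (fun u : ℝ => Real.exp (-b * |u| ^ α)) (Ioi (-0)) := by
      rwa [neg_zero]
    simpa only [abs_neg] using h0.comp_neg_Iio
  rw [← integrableOn_univ, ← Iic_union_Ioi (a := (0 : ℝ))]
  exact hneg.union hpos

/-- A bound `exp (-t c |u| ^ α)` on the characteristic functions for `|u| ≥ N` yields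
a bound `C / (t ^ (1 / α) ∧ 1)` on the densities. -/
theorem exists_le_smul_volume {α c N : ℝ} (hα : 0 < α) (hc : 0 < c) (hN : 0 < N) :
    ∃ C > 0, ∀ (P : Measure ℝ) [IsProbabilityMeasure P] (t : ℝ), 0 < t →
      (∀ u, N ≤ |u| → ‖charFun P u‖ ≤ Real.exp (-(t * c) * |u| ^ α)) →
      P ≤ (C / min (t ^ (1 / α)) 1).toNNReal • volume := by
  set K : ℝ := c ^ (-1 / α) * Real.Gamma (1 / α + 1) with hK
  have hK0 : 0 < K := mul_pos (by positivity) (Real.Gamma_pos_of_pos (by positivity))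
  -- `2 * N` comes from `[-N, N]`, where the trivial bound `1` is used; the exponential integrates
  -- to `2 * K * t ^ (-1 / α)`.
  refine ⟨2 * N + 2 * K, by positivity, fun P _ t ht hP => ?_⟩
  set G : ℝ → ℝ := fun u =>
    (Icc (-N) N).indicator (fun _ => (1 : ℝ)) u + Real.exp (-(t * c) * |u| ^ α) with hGdef
  have hind : Integrable ((Icc (-N) N).indicator fun _ => (1 : ℝ)) :=
    (integrable_indicator_iff measurableSet_Icc).2 (integrableOn_const (by simp))
  have hexp := integrable_exp_neg_mul_abs_rpow hα (mul_pos ht hc)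
  have hGP : ∀ u, ‖charFun P u‖ ≤ G u := by
    intro u
    rcases le_or_gt N |u| with hu | hu
    · exact (hP u hu).trans (le_add_of_nonneg_left (indicator_nonneg (by simp) _))
    · rw [hGdef]
      simp only
      rw [indicator_of_mem (mem_Icc.2 (abs_le.1 hu.le))]
      exact (norm_charFun_le_one u).trans (le_add_of_nonneg_right (Real.exp_pos _).le)
  have hGint : ∫ u, G u = 2 * N + 2 * (t ^ (-1 / α) * K) := by
    rw [hGdef, integral_add hind hexp, integral_indicator measurableSet_Icc,
      integral_comp_abs (f := fun x => Real.exp (-(t * c) * x ^ α)),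
      integral_exp_neg_mul_rpow hα (mul_pos ht hc), Real.mul_rpow ht.le hc.le, hK]
    simp only [setIntegral_const, smul_eq_mul, mul_one, Real.volume_real_Icc, sub_neg_eq_add]
    rw [max_eq_left (by linarith)]
    ring
  refine (le_smul_volume_of_norm_charFun_le (hind.add hexp) hGP).trans ?_
  have hle : ∫ u, G u ≤ (2 * N + 2 * K) / min (t ^ (1 / α)) 1 := by
    have hm : 0 < min (t ^ (1 / α)) 1 := lt_min (by positivity) one_pos
    have h1 : t ^ (-1 / α) = (t ^ (1 / α))⁻¹ := by
      rw [neg_div, Real.rpow_neg ht.le]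
    have h2 : (t ^ (1 / α))⁻¹ ≤ (min (t ^ (1 / α)) 1)⁻¹ := inv_anti₀ hm (min_le_left _ _)
    have h3 : 1 ≤ (min (t ^ (1 / α)) 1)⁻¹ := (one_le_inv₀ hm).2 (min_le_right _ _)
    rw [hGint, h1, div_eq_mul_inv (2 * N + 2 * K)]
    nlinarith [mul_le_mul_of_nonneg_right h2 hK0.le, mul_le_mul_of_nonneg_left h3 hN.le]
  refine Measure.le_iff'.2 fun s => ?_
  rw [Measure.smul_apply, Measure.smul_apply, ENNReal.smul_def, ENNReal.smul_def]
  gcongr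
  exact hle

/-- The laws of the Lévy processes whose Lévy measure dominates `μ` near the origin are bounded
by multiples of Lebesgue measure, uniformly in the process. -/
theorem exists_map_le_smul_volume {μ : Measure ℝ} {α ρ r : ℝ} (hα : 0 < α) (hαρ : α < ρ)
    (hr : 0 < r) (hμ : RegularlyVaryingAtZero (fun x => μ.real (Iic (-x) ∪ Ici x)) (-ρ)) :
    ∃ C > 0, ∀ ν : Measure ℝ, μ.restrict (Ioo (-r) r) ≤ ν →
      ∀ (Ω : Type u) [MeasurableSpace Ω] (P : Measure Ω) [IsProbabilityMeasure P]
        (Y : ℝ≥0 → Ω → ℝ), IsLevyProcessWithTriplet Y P 0 0 ν →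
      ∀ t : ℝ≥0, 0 < t →
        P.map (Y t) ≤ (C / min ((t : ℝ) ^ (1 / α)) 1).toNNReal • volume := by
  obtain ⟨c, hc, N, hN, hgrow⟩ := exists_mul_rpow_le_measureReal_annulus hα hαρ hμ
  have hpi := Real.pi_pos
  -- The condition `|u| ≥ 1 / r` places the annulus inside `(-r, r)`.
  obtain ⟨C, hC, hbound⟩ := exists_le_smul_volume (c := 1 / (2 * Real.pi ^ 2) * c)
    (N := max N (1 / r)) hα (by positivity) (lt_max_of_lt_left hN)
  refine ⟨C, hC, fun ν hμν Ω _ P _ Y hY t ht => ?_⟩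
  have := Measure.isProbabilityMeasure_map (μ := P) (hY.isLevyProcess.measurable t).aemeasurable
  refine hbound _ t (by exact_mod_cast ht) fun u hu => ?_
  have hu0 : 0 < |u| := hN.trans_le ((le_max_left _ _).trans hu)
  have hur : 1 / |u| ≤ r := (one_div_le hr hu0).1 ((le_max_right _ _).trans hu)
  rw [hY.charFun_eq, Complex.norm_exp, Real.exp_le_exp]
  have h1 := hY.isLevyMeasure.re_levyExponent_le hμν (abs_pos.1 hu0) hur
  have h2 := mul_le_mul_of_nonneg_left (hgrow |u| ((le_max_left _ _).trans hu))
    (by positivity : (0 : ℝ) ≤ 1 / (2 * Real.pi ^ 2))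
  have h3 : ((t : ℂ) * levyExponent 0 0 ν u).re = (t : ℝ) * (levyExponent 0 0 ν u).re :=
    Complex.re_ofReal_mul _ _
  rw [h3]
  have h4 := mul_le_mul_of_nonneg_left (h1.trans (neg_le_neg h2)) t.coe_nonneg
  linarith

/-- `ν` is the Lévy measure of a Lévy process `X` with triplet `(0, 0, ν)`; the process `X` enters
only through `ν`. The first conclusion is about every Lévy process `Y = X^{<γ}` with triplet
`(0, 0, ν|_{(-γ, γ)})`, on any probability space: `Y t` has a density with respect to Lebesgue
measure, whose essential supremum is at most `C / (t^{1/α} ∧ 1)`. -/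
theorem theorem2 (ν μ : Measure ℝ) (hν : IsLevyMeasure ν) (γ₀ α ε : ℝ) (hγ₀ : 0 < γ₀)
    (hα : α ∈ Ioo (0 : ℝ) 2) (hε : ε ∈ Ioo (0 : ℝ) (2 - α))
    (hμν : μ.restrict (Ioo (-γ₀) γ₀) ≤ ν.restrict (Ioo (-γ₀) γ₀))
    (hμ : RegularlyVaryingAtZero (fun x => μ.real (Iic (-x) ∪ Ici x)) (-(α + ε))) :
    (∃ C : ℝ, ∀ γ : ℝ, γ₀ ≤ γ →
      ∀ (Ω : Type u) [MeasurableSpace Ω] (P : Measure Ω) [IsProbabilityMeasure P]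
        (Y : ℝ≥0 → Ω → ℝ), IsLevyProcessWithTriplet Y P 0 0 (ν.restrict (Ioo (-γ) γ)) →
      ∀ t : ℝ≥0, 0 < t →
        HasPDF (Y t) P volume ∧
          eLpNorm (pdf (Y t) P volume) ∞ volume
            ≤ ENNReal.ofReal (C / min ((t : ℝ) ^ (1 / α)) 1)) ∧
    SmallJumpAnticoncentration.{u} 0 0 ν 1 := by
  have hα0 : 0 < α := hα.1
  have hαε : α < α + ε := lt_add_of_pos_right α hε.1
  have hrestrict : ∀ {r : ℝ} {s : Set ℝ}, r ≤ γ₀ → Ioo (-r) r ⊆ s →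
      μ.restrict (Ioo (-r) r) ≤ ν.restrict s := by
    intro r s hr hs
    have hsub : Ioo (-r) r ⊆ Ioo (-γ₀) γ₀ := Ioo_subset_Ioo (neg_le_neg hr) hr
    calc μ.restrict (Ioo (-r) r)
        = (μ.restrict (Ioo (-γ₀) γ₀)).restrict (Ioo (-r) r) :=
          (Measure.restrict_restrict_of_subset hsub).symm
      _ ≤ (ν.restrict (Ioo (-γ₀) γ₀)).restrict (Ioo (-r) r) := Measure.restrict_mono_measure hμν _
      _ = ν.restrict (Ioo (-r) r) := Measure.restrict_restrict_of_subset hsub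
      _ ≤ ν.restrict s := Measure.restrict_mono_set ν hs
  refine ⟨?_, fun z₀ hz₀ => ?_⟩
  · obtain ⟨C, -, h⟩ := exists_map_le_smul_volume.{u} hα0 hαε hγ₀ hμ
    refine ⟨C, fun γ hγ Ω _ P _ Y hY t ht => ?_⟩
    exact hasPDF_and_eLpNorm_pdf_le (hY.isLevyProcess.measurable t)
      (h _ (hrestrict le_rfl (Ioo_subset_Ioo (neg_le_neg hγ) hγ)) Ω P Y hY t ht)
  -- The radius `min γ₀ z₀` keeps `(-r, r)` inside `(-∞, z)` for every `z ≥ z₀`.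
  · obtain ⟨C, hC, h⟩ := exists_map_le_smul_volume.{u} hα0 hαε (lt_min hγ₀ hz₀) hμ
    refine ⟨C, hC, 1 / α, by positivity, fun z hz Ω _ P _ Y hY t ht x δ hδ => ?_⟩
    have hle := h _ (hrestrict (min_le_left _ _)
      fun y hy => hy.2.trans_le ((min_le_right _ _).trans hz)) Ω P Y hY t ht (Icc x (x + δ))
    have ht' : (0 : ℝ) < t := by exact_mod_cast ht
    have hm : 0 < min ((t : ℝ) ^ (1 / α)) 1 := lt_min (by positivity) one_pos
    rw [Measure.map_apply (hY.isLevyProcess.measurable t) measurableSet_Icc] at hle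
    rw [Real.rpow_one]
    refine ENNReal.toReal_le_of_le_ofReal (mul_nonneg (by positivity) hδ.1) (hle.trans ?_)
    rw [Measure.smul_apply, Real.volume_Icc, add_sub_cancel_left, ENNReal.smul_def, smul_eq_mul,
      ENNReal.ofReal_mul (by positivity)]
    rfl
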